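/- For a complex Lie algebra $\mathfrak{g}$, say that $\mathfrak{g}$ is defined over $\mathbb{R}$ if there is a real Lie algebra $\mathfrak{k}$ such that $\mathfrak{g}$ is isomorphic, as a complex Lie algebra, to $\mathfrak{k}\otimes_{\mathbb{R}}\mathbb{C}$. The complex conjugate $\overline{\mathfrak{g}}$ of $\mathfrak{g}$ is the complex Lie algebra, unique up to isomorphism, for which there is an additive bijection $\varphi:\mathfrak{g}\to\overline{\mathfrak{g}}$ with $\varphi(\lambda X)=\overline{\lambda}\,\varphi(X)$ and $\varphi([X,Y])=[\varphi(X),\varphi(Y)]$ for all $\lambda\in\mathbb{C}$ and $X,Y\in\mathfrak{g}$; concretely, one can take for $\overline{\mathfrak{g}}$ the same underlying Lie ring with the scalar multiplication $(\lambda,X)\mapsto\overline{\lambda}X$. Let $\mathfrak{g}$ be a complex Lie algebra of (finite) dimension at most $4$. Then $\mathfrak{g}$ is defined over $\mathbb{R}$ if and only if $\mathfrak{g}$ and $\overline{\mathfrak{g}}$ are isomorphic as complex Lie algebras. -/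

import Mathlib

open scoped TensorProduct

universe u

/-- A Lie algebra `L` over `E` is defined over `F` (where `E` is an extension of `F`) if it is
isomorphic, as a Lie algebra over `E`, to the extension of scalars `E ⊗[F] K` of some Lie algebra
`K` over `F`. -/
def IsDefinedOver (F E : Type*) [Field F] [Field E] [Algebra F E]
    (L : Type u) [LieRing L] [LieAlgebra E L] : Prop :=
  ∃ (K : Type u) (_ : LieRing K) (_ : LieAlgebra F K), Nonempty ((E ⊗[F] K) ≃ₗ⁅E⁆ L)

/-- The `σ`-conjugate of a Lie algebra `L` over a field `E`, for an automorphism `σ` of `E`: it has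
the same elements, the same addition and the same bracket as `L`, and `c` acts on it as
`σ⁻¹ c` acts on `L`, so that the identity map from `L` is a `σ`-isomorphism. -/
def ConjugateLie {E : Type*} [Field E] (_σ : E ≃+* E) (L : Type u) : Type u := L

namespace ConjugateLie

variable {E : Type*} [Field E] (σ : E ≃+* E) (L : Type u) [LieRing L] [LieAlgebra E L]

instance : LieRing (ConjugateLie σ L) := inferInstanceAs (LieRing L)

instance : Module E (ConjugateLie σ L) := Module.compHom L (σ.symm : E →+* E)

/-- The identity map of `L`, as an additive bijection from `L` onto its `σ`-conjugate. -/
def of : L ≃+ ConjugateLie σ L := AddEquiv.refl L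

theorem smul_of (c : E) (x : L) : c • of σ L x = of σ L (σ.symm c • x) := rfl

theorem of_smul (c : E) (x : L) : of σ L (c • x) = σ c • of σ L x := by
  rw [smul_of, σ.symm_apply_apply]

theorem of_lie (x y : L) : of σ L ⁅x, y⁆ = ⁅of σ L x, of σ L y⁆ := rfl

instance : LieAlgebra E (ConjugateLie σ L) where
  lie_smul c x y := lie_smul (σ.symm c) (show L from x) (show L from y)

/-- The `σ`-conjugate is, up to isomorphism, the only Lie algebra that is `σ`-isomorphic
to `L`. -/
theorem nonempty_equiv_iff (H : Type*) [LieRing H] [LieAlgebra E H] :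
    Nonempty (H ≃ₗ⁅E⁆ ConjugateLie σ L) ↔
      ∃ φ : L ≃+ H, (∀ (c : E) (x : L), φ (c • x) = σ c • φ x) ∧
        ∀ x y : L, φ ⁅x, y⁆ = ⁅φ x, φ y⁆ := by
  constructor
  · rintro ⟨e⟩
    refine ⟨(of σ L).trans e.symm.toLinearEquiv.toAddEquiv, fun c x => ?_, fun x y => ?_⟩
    · change e.symm (of σ L (c • x)) = σ c • e.symm (of σ L x)
      rw [of_smul]
      exact map_smul e.symm.toLinearEquiv _ _
    · change e.symm (of σ L ⁅x, y⁆) = ⁅e.symm (of σ L x), e.symm (of σ L y)⁆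
      rw [of_lie]
      exact LieHom.map_lie e.symm.toLieHom _ _
  · rintro ⟨φ, hs, hl⟩
    refine ⟨LieEquiv.symm
      { toFun := fun x => φ ((of σ L).symm x)
        invFun := fun y => of σ L (φ.symm y)
        map_add' := fun x y => by simp
        map_smul' := fun c x => ?_
        map_lie' := fun {x y} => hl ((of σ L).symm x) ((of σ L).symm y)
        left_inv := fun x => by simp
        right_inv := fun y => by simp }⟩
    change φ (σ.symm c • (of σ L).symm x) = c • φ ((of σ L).symm x)
    rw [hs, σ.apply_symm_apply]

end ConjugateLie

/-- The complex conjugate of a complex Lie algebra. -/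
abbrev ComplexConjugateLie (L : Type u) : Type u := ConjugateLie (starRingAut : ℂ ≃+* ℂ) L

/-! ### Real structures and antilinear involutions. -/

section RealStructure

open ComplexConjugate

variable {L : Type u} [LieRing L] [LieAlgebra ℂ L]

/-! A complex Lie algebra has a real form exactly when it has an antilinear automorphism `τ` with
`τ² = 1`: the real form is the fixed set of `τ`. An isomorphism with the conjugate is only an
antilinear automorphism `φ`, so the task is to improve `φ` until its square is trivial.

In any finite dimension, `φ` can be changed so that `φ²` has order a power of 2. The unipotent part
of `φ²` is removed by a binomial power with exponent `-1/2`, its eigenvalues are turned into roots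
of unity by a multiplicative function on `ℂˣ`, and an odd factor of the order is removed by
composing with a power of `φ²` (`exists_antilinear_two_power_order`).

The bound on the dimension enters in `exists_antilinear_involution_of_two_power_order`. If `θ = φ ^
(2 ^ (k + 1))` is a nontrivial involution, it grades the algebra as `P ⊕ Q`. An antilinear map makes
eigenvectors of `φ²` in `Q` come in pairs `y`, `φ y`, which leaves room only for an abelian algebra
or for `dim Q = 2` and `dim P ≤ 2`. In the latter case either `φ` can be rescaled on `Q` to an
involution, or all brackets vanish; abelian algebras have an obvious involution. -/

theorem map_lie_of_map_lie_tmul {K N : Type*} [LieRing K] [LieAlgebra ℝ K] [LieRing N]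
    (f : ℂ ⊗[ℝ] K →+ N)
    (hf : ∀ (z w : ℂ) (x y : K), f ((z * w) ⊗ₜ ⁅x, y⁆) = ⁅f (z ⊗ₜ x), f (w ⊗ₜ y)⁆)
    (a b : ℂ ⊗[ℝ] K) : f ⁅a, b⁆ = ⁅f a, f b⁆ := by
  have zero_l : ∀ b : ℂ ⊗[ℝ] K, ⁅(0 : ℂ ⊗[ℝ] K), b⁆ = 0 := fun b =>
    zero_lie (L := ℂ ⊗[ℝ] K) (M := ℂ ⊗[ℝ] K) b
  have zero_r : ∀ a : ℂ ⊗[ℝ] K, ⁅a, (0 : ℂ ⊗[ℝ] K)⁆ = 0 := fun a =>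
    lie_zero (L := ℂ ⊗[ℝ] K) (M := ℂ ⊗[ℝ] K) a
  have add_l : ∀ a a' b : ℂ ⊗[ℝ] K, ⁅a + a', b⁆ = ⁅a, b⁆ + ⁅a', b⁆ := fun a a' b =>
    add_lie (L := ℂ ⊗[ℝ] K) (M := ℂ ⊗[ℝ] K) a a' b
  have add_r : ∀ a b b' : ℂ ⊗[ℝ] K, ⁅a, b + b'⁆ = ⁅a, b⁆ + ⁅a, b'⁆ := fun a b b' =>
    lie_add (L := ℂ ⊗[ℝ] K) (M := ℂ ⊗[ℝ] K) a b b'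
  induction a using TensorProduct.induction_on with
  | zero => rw [zero_l, map_zero, zero_lie]
  | add a a' h h' => rw [add_l, map_add, map_add, add_lie, h, h']
  | tmul z x =>
    induction b using TensorProduct.induction_on with
    | zero => rw [zero_r, map_zero, lie_zero]
    | add b b' h h' => rw [add_r, map_add, map_add, lie_add, h, h']
    | tmul w y => rw [LieAlgebra.ExtendScalars.bracket_tmul, hf]

/-- Galois descent for `ℂ/ℝ`: the fixed points `K` of `τ` form a real Lie subalgebra, and `L = K ⊕
iK`. -/
theorem isDefinedOver_real_of_involution (τ : L →ₛₗ[starRingEnd ℂ] L)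
    (hτ : ∀ x y, τ ⁅x, y⁆ = ⁅τ x, τ y⁆) (hinv : ∀ x, τ (τ x) = x) : IsDefinedOver ℝ ℂ L := by
  let _ : LieAlgebra ℝ L :=
    { (inferInstance : Module ℝ L) with
      lie_smul := fun c x y => lie_smul (c : ℂ) x y }
  let K : LieSubalgebra ℝ L :=
    { carrier := {x | τ x = x}
      add_mem' := fun {x y} hx hy => by
        simp only [Set.mem_ofPred_eq] at *
        rw [map_add, hx, hy]
      zero_mem' := map_zero τ
      smul_mem' := fun c x hx => by
        change τ ((c : ℂ) • x) = (c : ℂ) • x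
        rw [map_smulₛₗ, Complex.conj_ofReal]
        exact congrArg _ hx
      lie_mem' := fun {x y} hx hy => by
        change τ ⁅x, y⁆ = ⁅x, y⁆
        rw [hτ]
        exact congrArg₂ _ hx hy }
  have hK : ∀ x : L, x ∈ K ↔ τ x = x := fun x => Iff.rfl
  have lie_coe : ∀ x y : K, ((⁅x, y⁆ : K) : L) = ⁅(x : L), (y : L)⁆ := fun x y => rfl
  let f : ℂ ⊗[ℝ] K →ₗ[ℂ] L :=
    TensorProduct.AlgebraTensorModule.lift
      { toFun := fun z =>
          { toFun := fun x => z • (x : L)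
            map_add' := fun x y => by simp
            map_smul' := fun c x => by
              exact smul_comm z c (x : L) }
        map_add' := fun z w => by ext x; simp [add_smul]
        map_smul' := fun z w => by ext x; simp [mul_smul] }
  have f_tmul : ∀ (z : ℂ) (x : K), f (z ⊗ₜ x) = z • (x : L) := fun z x => by
    simp [f]
  have f_lie : ∀ a b, f ⁅a, b⁆ = ⁅f a, f b⁆ :=
    map_lie_of_map_lie_tmul f.toAddMonoidHom fun z w x y => by
      rw [LinearMap.toAddMonoidHom_coe, f_tmul, f_tmul, f_tmul, lie_coe, smul_lie, lie_smul, mul_smul]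
  have hI : Complex.I * Complex.I = -1 := Complex.I_mul_I
  have hre : ∀ x : L, (2⁻¹ : ℂ) • (x + τ x) ∈ K := fun x => by
    rw [hK, map_smulₛₗ, map_add, hinv, add_comm, map_inv₀, Complex.conj_ofNat]
  -- The imaginary part of `x`: the factor is `1 / (2i)`.
  have him : ∀ x : L, (-(Complex.I / 2)) • (x - τ x) ∈ K := fun x => by
    
    rw [hK, map_smulₛₗ, map_sub, hinv, ← neg_sub, smul_neg, ← neg_smul, map_neg, map_div₀,
      Complex.conj_I, Complex.conj_ofNat, neg_div, neg_neg]
  have hsurj : Function.Surjective f := fun x => by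
    refine ⟨(1 : ℂ) ⊗ₜ ⟨_, hre x⟩ + Complex.I ⊗ₜ ⟨_, him x⟩, ?_⟩
    rw [map_add, f_tmul, f_tmul, one_smul, smul_smul]
    have : Complex.I * -(Complex.I / 2) = 2⁻¹ := by linear_combination (-1 / 2) * hI
    simp only [this]
    module
  have hform : ∀ a : ℂ ⊗[ℝ] K, ∃ x y : K, a = (1 : ℂ) ⊗ₜ x + Complex.I ⊗ₜ y := by
    intro a
    induction a using TensorProduct.induction_on with
    | zero => exact ⟨0, 0, by simp⟩
    | add a a' h h' =>
      obtain ⟨x, y, rfl⟩ := h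
      obtain ⟨x', y', rfl⟩ := h'
      exact ⟨x + x', y + y', by simp only [TensorProduct.tmul_add]; abel⟩
    | tmul z x =>
      refine ⟨z.re • x, z.im • x, ?_⟩
      rw [← TensorProduct.smul_tmul, ← TensorProduct.smul_tmul, ← TensorProduct.add_tmul]
      congr 1
      apply Complex.ext <;> simp
  have hinj : Function.Injective f := by
    rw [injective_iff_map_eq_zero]
    intro a ha
    obtain ⟨x, y, rfl⟩ := hform a
    rw [map_add, f_tmul, f_tmul, one_smul] at ha
    have hx : τ x = x := x.2
    have hy : τ y = y := y.2
    have h2 := congrArg τ ha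
    rw [map_add, map_smulₛₗ, hx, hy, Complex.conj_I, map_zero] at h2
    have hx0 : (x : L) = 0 := by
      have : (2 : ℂ) • (x : L) = 0 := by
        calc (2 : ℂ) • (x : L) = ((x : L) + Complex.I • (y : L)) + (x + -Complex.I • (y : L)) := by
              module
          _ = 0 := by rw [ha, h2, add_zero]
      simpa using this
    have hy0 : (y : L) = 0 := by
      rw [hx0, zero_add] at ha
      simpa [Complex.I_ne_zero] using ha
    rw [show x = 0 from Subtype.ext hx0, show y = 0 from Subtype.ext hy0]
    simp
  refine ⟨K, inferInstance, inferInstance, ⟨?_⟩⟩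
  exact LieEquiv.ofBijective { f with map_lie' := fun {a b} => f_lie a b } ⟨hinj, hsurj⟩

/-- Complex conjugation on the first tensor factor, transported along the isomorphism. -/
theorem exists_conj_equiv_of_isDefinedOver (h : IsDefinedOver ℝ ℂ L) :
    ∃ φ : L ≃+ L, (∀ (c : ℂ) (x : L), φ (c • x) = conj c • φ x) ∧
      ∀ x y : L, φ ⁅x, y⁆ = ⁅φ x, φ y⁆ := by
  obtain ⟨K, _, _, ⟨e⟩⟩ := h
  let s : ℂ ⊗[ℝ] K ≃ₗ[ℝ] ℂ ⊗[ℝ] K :=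
    TensorProduct.congr Complex.conjAe.toLinearEquiv (LinearEquiv.refl ℝ K)
  have s_tmul : ∀ (z : ℂ) (x : K), s (z ⊗ₜ x) = conj z ⊗ₜ x := fun z x => rfl
  have s_smul : ∀ (c : ℂ) (a : ℂ ⊗[ℝ] K), s (c • a) = conj c • s a := by
    intro c a
    induction a using TensorProduct.induction_on with
    | zero => simp
    | add a a' h h' => simp only [smul_add, map_add, h, h']
    | tmul z x => simp only [TensorProduct.smul_tmul', s_tmul, smul_eq_mul, map_mul]
  have s_lie : ∀ a b : ℂ ⊗[ℝ] K, s ⁅a, b⁆ = ⁅s a, s b⁆ :=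
    map_lie_of_map_lie_tmul s.toAddEquiv.toAddMonoidHom fun z w x y => by
      change s _ = ⁅s _, s _⁆
      rw [s_tmul, s_tmul, s_tmul, map_mul, LieAlgebra.ExtendScalars.bracket_tmul]
  refine ⟨(e.symm.toLinearEquiv.toAddEquiv.trans s.toAddEquiv).trans e.toLinearEquiv.toAddEquiv,
    fun c x => ?_, fun x y => ?_⟩
  · change e (s (e.symm (c • x))) = conj c • e (s (e.symm x))
    rw [show e.symm (c • x) = c • e.symm x from map_smul e.symm.toLinearEquiv c x, s_smul]
    exact map_smul e.toLinearEquiv _ _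
  · change e (s (e.symm ⁅x, y⁆)) = ⁅e (s (e.symm x)), e (s (e.symm y))⁆
    rw [LieEquiv.map_lie, s_lie, LieEquiv.map_lie]

end RealStructure

/-! ### Complex powers of unipotent endomorphisms. -/

section BinomialPower

open Polynomial ComplexConjugate

variable {M : Type*} [AddCommGroup M] [Module ℂ M]

theorem Polynomial.eq_zero_of_eval_natCast {p : ℂ[X]} (h : ∀ m : ℕ, p.eval (m : ℂ) = 0) :
    p = 0 :=
  p.eq_zero_of_infinite_isRoot <|
    (Set.infinite_range_of_injective Nat.cast_injective).mono (by rintro _ ⟨m, rfl⟩; exact h m)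

/-- Vector-valued polynomial identities extend from `ℕ` to `ℂ`: a linear functional reduces them to
a scalar polynomial with infinitely many roots. The laws for `binomialPow` below follow from those
for ordinary powers in this way. -/
theorem sum_eval_smul_eq_of_natCast {ι κ : Type*} (s : Finset ι) (t : Finset κ) (p : ι → ℂ[X])
    (q : κ → ℂ[X]) (v : ι → M) (w : κ → M)
    (h : ∀ m : ℕ, ∑ i ∈ s, (p i).eval (m : ℂ) • v i = ∑ j ∈ t, (q j).eval (m : ℂ) • w j) (a : ℂ) :
    ∑ i ∈ s, (p i).eval a • v i = ∑ j ∈ t, (q j).eval a • w j := by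
  rw [← sub_eq_zero, ← Module.forall_dual_apply_eq_zero_iff ℂ]
  intro ℓ
  let r : ℂ[X] := ∑ i ∈ s, p i * C (ℓ (v i)) - ∑ j ∈ t, q j * C (ℓ (w j))
  have hr : ∀ a, r.eval a =
      ℓ (∑ i ∈ s, (p i).eval a • v i - ∑ j ∈ t, (q j).eval a • w j) := fun a => by
    simp [r, eval_finsetSum]
  rw [← hr, Polynomial.eq_zero_of_eval_natCast (p := r), eval_zero]
  intro m
  rw [hr, h, sub_self, map_zero]

/-- The polynomial whose value at `a` is the binomial coefficient `a.choose k`. -/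
noncomputable def binomialPoly (k : ℕ) : ℂ[X] := C ((k.factorial : ℂ)⁻¹) * descPochhammer ℂ k

theorem binomialPoly_eval_natCast (k m : ℕ) : (binomialPoly k).eval (m : ℂ) = m.choose k := by
  rw [binomialPoly, eval_mul, eval_C, descPochhammer_eval_eq_descFactorial,
    Nat.descFactorial_eq_factorial_mul_choose, Nat.cast_mul,
    inv_mul_cancel_left₀ (Nat.cast_ne_zero.2 k.factorial_ne_zero)]

theorem conj_binomialPoly_eval (k : ℕ) (a : ℂ) :
    conj ((binomialPoly k).eval a) = (binomialPoly k).eval (conj a) := by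
  simp [binomialPoly, descPochhammer_eval_eq_prod_range]

/-- The power `(1 + N) ^ a`, by the binomial series, of an endomorphism with `N ^ n = 0`. -/
noncomputable def binomialPow (n : ℕ) (N : Module.End ℂ M) (a : ℂ) : Module.End ℂ M :=
  ∑ k ∈ Finset.range n, (binomialPoly k).eval a • N ^ k

theorem binomialPow_apply (n : ℕ) (N : Module.End ℂ M) (a : ℂ) (x : M) :
    binomialPow n N a x = ∑ k ∈ Finset.range n, (binomialPoly k).eval a • (N ^ k) x := by
  simp [binomialPow]

theorem binomialPow_natCast {n : ℕ} {N : Module.End ℂ M} (hN : N ^ n = 0) (m : ℕ) :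
    binomialPow n N m = (1 + N) ^ m := by
  have hN' : ∀ k, n ≤ k → N ^ k = 0 := fun k hk => pow_eq_zero_of_le hk hN
  rw [add_comm, (Commute.one_right N).add_pow]
  have h1 : binomialPow n N m = ∑ k ∈ Finset.range (n + (m + 1)), (m.choose k : ℂ) • N ^ k := by
    simp only [binomialPow, binomialPoly_eval_natCast]
    refine Finset.sum_subset (Finset.range_subset_range.2 (by omega)) fun k _ hk => ?_
    rw [hN' k (by simpa using hk), smul_zero]
  rw [h1]
  symm
  have h2 : ∑ k ∈ Finset.range (m + 1), N ^ k * 1 ^ (m - k) * (m.choose k : Module.End ℂ M) =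
      ∑ k ∈ Finset.range (m + 1), (m.choose k : ℂ) • N ^ k := by
    refine Finset.sum_congr rfl fun k _ => ?_
    rw [one_pow, mul_one, ← nsmul_eq_mul', Nat.cast_smul_eq_nsmul]
  rw [h2]
  refine Finset.sum_subset (Finset.range_subset_range.2 (by omega)) fun k _ hk => ?_
  rw [Nat.choose_eq_zero_of_lt (by simpa using hk), Nat.cast_zero, zero_smul]

theorem binomialPow_comm (n : ℕ) (N : Module.End ℂ M) {A : Module.End ℂ M} (h : Commute N A)
    (a : ℂ) : Commute (binomialPow n N a) A :=
  Commute.sum_left _ _ _ fun _ _ => (h.pow_left _).smul_left _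

theorem binomialPow_add_of_natCast {n : ℕ} {N : Module.End ℂ M} (b : ℂ)
    (h : ∀ m : ℕ, binomialPow n N (m + b) = binomialPow n N m * binomialPow n N b) (a : ℂ) :
    binomialPow n N (a + b) = binomialPow n N a * binomialPow n N b := by
  have := sum_eval_smul_eq_of_natCast (Finset.range n) (Finset.range n)
    (fun k => (binomialPoly k).comp (X + C b)) binomialPoly (fun k => N ^ k)
    (fun k => N ^ k * binomialPow n N b) (fun m => by
      simpa [binomialPow, Finset.sum_mul] using h m) a
  simpa [binomialPow, Finset.sum_mul] using this

theorem binomialPow_add {n : ℕ} {N : Module.End ℂ M} (hN : N ^ n = 0) (a b : ℂ) :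
    binomialPow n N (a + b) = binomialPow n N a * binomialPow n N b := by
  -- The extension from `ℕ` to `ℂ` is made in one exponent at a time.
  refine binomialPow_add_of_natCast b (fun m => ?_) a
  rw [add_comm, binomialPow_add_of_natCast (m : ℂ) (fun l => ?_) b]
  · exact binomialPow_comm n N ((binomialPow_comm n N (Commute.refl N) _).symm) _
  · rw [← Nat.cast_add, binomialPow_natCast hN, binomialPow_natCast hN, binomialPow_natCast hN,
      pow_add]

/-- Binomial polynomials have rational coefficients, so only the exponent gets conjugated; a real
power commutes with `φ`. -/
theorem map_binomialPow {n : ℕ} {N : Module.End ℂ M} {φ : M →ₛₗ[starRingEnd ℂ] M}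
    (h : ∀ x, φ (N x) = N (φ x)) (a : ℂ) (x : M) :
    φ (binomialPow n N a x) = binomialPow n N (conj a) (φ x) := by
  have hk : ∀ (k : ℕ) (x : M), φ ((N ^ k) x) = (N ^ k) (φ x) := fun k => by
    induction k with
    | zero => simp
    | succ k ih => intro x; rw [pow_succ, Module.End.mul_apply, ih, h, Module.End.mul_apply]
  simp only [binomialPow_apply, map_sum, map_smulₛₗ, conj_binomialPoly_eval, hk]

theorem binomialPow_lie {L : Type*} [LieRing L] [LieAlgebra ℂ L] {n : ℕ} {N : Module.End ℂ L}
    (hN : N ^ n = 0) (h : ∀ x y, (1 + N) ⁅x, y⁆ = ⁅(1 + N) x, (1 + N) y⁆) (a : ℂ) (x y : L) :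
    binomialPow n N a ⁅x, y⁆ = ⁅binomialPow n N a x, binomialPow n N a y⁆ := by
  have key : ∀ a : ℂ, ⁅binomialPow n N a x, binomialPow n N a y⁆ =
      ∑ i ∈ Finset.range n ×ˢ Finset.range n,
        (binomialPoly i.1 * binomialPoly i.2).eval a • ⁅(N ^ i.1) x, (N ^ i.2) y⁆ := fun a => by
    simp only [binomialPow_apply, sum_lie, lie_sum, smul_lie, lie_smul,
      Finset.sum_product, eval_mul]
    rw [Finset.sum_comm]
    refine Finset.sum_congr rfl fun j _ => ?_
    rw [Finset.smul_sum]
    refine Finset.sum_congr rfl fun i _ => ?_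
    rw [smul_smul, mul_comm]
  rw [key, binomialPow_apply]
  refine sum_eval_smul_eq_of_natCast _ _ _ _ _ _ (fun m => ?_) a
  rw [← key, ← binomialPow_apply, binomialPow_natCast hN]
  induction m with
  | zero => simp
  | succ m ih => rw [pow_succ', Module.End.mul_apply, ih, h]; rfl

end BinomialPower

/-! ### A multiplicative correction of eigenvalues to roots of unity. -/

section MultiplicativeSquareRoot

open ComplexConjugate

/-- A multiplicative inverse square root does not exist on all of `ℂˣ`, because of the ambiguity
`2πi` of the logarithm. A `ℚ`-linear projection `P` of `ℝ` onto `2πℚ` absorbs it: `f (exp z) = exp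
(-(z - i P (Im z)) / 2)` is well defined, since `P` fixes `2πℤ`, and commutes with conjugation. Then
`a * f a ^ 2 = exp (i P (arg a))` is a root of unity. -/
theorem exists_multiplicative_root_of_unity_correction :
    ∃ f : ℂ → ℂ, (∀ a b, a ≠ 0 → b ≠ 0 → f (a * b) = f a * f b) ∧
      ∀ a, a ≠ 0 → ∃ n, 0 < n ∧ (a * f a * conj (f (conj a))) ^ n = 1 := by
  obtain ⟨π, hπ⟩ := LinearMap.exists_leftInverse_of_injective (Algebra.linearMap ℚ ℝ)
    (LinearMap.ker_eq_bot.2 (algebraMap ℚ ℝ).injective)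
  have hπ' : ∀ q : ℚ, π q = q := fun q => LinearMap.congr_fun hπ q
  let P : ℝ → ℝ := fun y => π (y / (2 * Real.pi)) * (2 * Real.pi)
  have P_add : ∀ x y, P (x + y) = P x + P y := fun x y => by
    simp only [P, add_div, map_add, Rat.cast_add, add_mul]
  have P_neg : ∀ x, P (-x) = -P x := fun x => by
    simp only [P, neg_div, map_neg, Rat.cast_neg, neg_mul]
  have h2pi : (2 * Real.pi) ≠ 0 := by positivity
  have P_int : ∀ n : ℤ, P (n * (2 * Real.pi)) = n * (2 * Real.pi) := fun n => by
    simp only [P, mul_div_cancel_right₀ _ h2pi]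
    rw [show (n : ℝ) = ((n : ℚ) : ℝ) by norm_cast, hπ']
  let E : ℂ → ℂ := fun z => Complex.exp (-(z - P z.im * Complex.I) / 2)
  have E_add : ∀ z w, E (z + w) = E z * E w := fun z w => by
    simp only [E, ← Complex.exp_add, Complex.add_im, P_add, Complex.ofReal_add]
    congr 1; ring
  have E_per : ∀ z w, Complex.exp z = Complex.exp w → E z = E w := fun z w h => by
    obtain ⟨n, rfl⟩ := Complex.exp_eq_exp_iff_exists_int.1 h
    have him : ((n : ℂ) * (2 * Real.pi * Complex.I)).im = n * (2 * Real.pi) := by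
      simp
    have : E (n * (2 * Real.pi * Complex.I)) = 1 := by
      simp only [E]
      rw [him, P_int]
      rw [show -((n : ℂ) * (2 * Real.pi * Complex.I) - ((n * (2 * Real.pi) : ℝ) : ℂ) * Complex.I) / 2
        = 0 by push_cast; ring, Complex.exp_zero]
    rw [E_add, this, mul_one]
  have E_conj : ∀ z, conj (E (conj z)) = E z := fun z => by
    simp only [E, ← Complex.exp_conj, Complex.conj_im, P_neg]
    congr 1
    simp only [map_div₀, map_neg, map_sub, map_mul, Complex.conj_conj, Complex.conj_ofReal,
      Complex.conj_I, Complex.conj_ofNat, Complex.ofReal_neg, neg_mul, mul_neg, neg_neg]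
  refine ⟨fun a => E (Complex.log a), fun a b ha hb => ?_, fun a ha => ?_⟩
  · rw [← E_add]
    refine E_per _ _ ?_
    rw [Complex.exp_add, Complex.exp_log ha, Complex.exp_log hb, Complex.exp_log (mul_ne_zero ha hb)]
  · have h1 : E (Complex.log (conj a)) = E (conj (Complex.log a)) := by
      refine E_per _ _ ?_
      rw [Complex.exp_conj, Complex.exp_log ha,
        Complex.exp_log ((map_ne_zero_iff _ (starRingEnd ℂ).injective).2 ha)]
    simp only [h1, E_conj]
    set z := Complex.log a
    have h2 : a * E z * E z = Complex.exp (P z.im * Complex.I) := by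
      rw [← Complex.exp_log ha]
      simp only [E, ← Complex.exp_add]
      congr 1
      simp only [z]
      ring
    set q := π (z.im / (2 * Real.pi)) with hq
    refine ⟨q.den, q.den_pos, ?_⟩
    rw [h2, ← Complex.exp_nat_mul]
    refine Complex.exp_eq_one_iff.2 ⟨q.num, ?_⟩
    have hqd : (q.den : ℂ) * (q : ℂ) = q.num := by
      exact_mod_cast Rat.den_mul_eq_num q
    simp only [P, ← hq]
    push_cast
    linear_combination (2 * Real.pi * Complex.I) * hqd

end MultiplicativeSquareRoot

/-! ### Generalized eigenspaces of a Lie algebra automorphism. -/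

section GeneralizedEigenspaces

open ComplexConjugate

variable {L : Type*}

section Module

variable [AddCommGroup L] [Module ℂ L] [FiniteDimensional ℂ L]

theorem maxGenEigenspace_induction (g : Module.End ℂ L) {p : L → Prop}
    (h : ∀ a, ∀ x ∈ g.maxGenEigenspace a, p x) (h0 : p 0) (hadd : ∀ x y, p x → p y → p (x + y))
    (x : L) : p x :=
  Submodule.iSup_induction (motive := p) g.maxGenEigenspace
    (by rw [Module.End.iSup_maxGenEigenspace_eq_top g]; trivial) h h0 hadd

theorem linearMap_ext_maxGenEigenspace (g : Module.End ℂ L) {A B : Module.End ℂ L}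
    (h : ∀ a, ∀ x ∈ g.maxGenEigenspace a, A x = B x) : A = B :=
  LinearMap.ext <| maxGenEigenspace_induction g h (by simp) fun x y hx hy => by
    rw [map_add, map_add, hx, hy]

theorem exists_scalar_on_maxGenEigenspace (g : Module.End ℂ L) (c : ℂ → ℂ) :
    ∃ T : Module.End ℂ L, ∀ a, ∀ x ∈ g.maxGenEigenspace a, T x = c a • x := by
  classical
  have hint : DirectSum.IsInternal g.maxGenEigenspace :=
    DirectSum.isInternal_submodule_of_iSupIndep_of_iSup_eq_top
      g.independent_maxGenEigenspace (Module.End.iSup_maxGenEigenspace_eq_top g)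
  let e := LinearEquiv.ofBijective (DirectSum.coeLinearMap g.maxGenEigenspace) hint
  let F : (DirectSum ℂ fun a => g.maxGenEigenspace a) →ₗ[ℂ] L :=
    DirectSum.toModule ℂ ℂ L fun a => c a • (g.maxGenEigenspace a).subtype
  refine ⟨F ∘ₗ e.symm.toLinearMap, fun a x hx => ?_⟩
  have : e.symm x = DirectSum.lof ℂ ℂ (fun a => g.maxGenEigenspace a) a ⟨x, hx⟩ := by
    rw [LinearEquiv.symm_apply_eq]
    exact (DirectSum.coeLinearMap_lof g.maxGenEigenspace a ⟨x, hx⟩).symm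
  rw [LinearMap.comp_apply, LinearEquiv.coe_coe, this]
  simp [F]

theorem mem_maxGenEigenspace_iff_finrank (g : Module.End ℂ L) (a : ℂ) (x : L) :
    x ∈ g.maxGenEigenspace a ↔ ((g - a • 1) ^ Module.finrank ℂ L) x = 0 := by
  rw [Module.End.maxGenEigenspace_eq_genEigenspace_finrank, Module.End.mem_genEigenspace_nat,
    LinearMap.mem_ker]

end Module

theorem lie_mem_maxGenEigenspace_of_map_lie [LieRing L] [LieAlgebra ℂ L] {g : Module.End ℂ L}
    (hg : ∀ x y, g ⁅x, y⁆ = ⁅g x, g y⁆) {a b : ℂ} {x y : L}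
    (hx : x ∈ g.maxGenEigenspace a) (hy : y ∈ g.maxGenEigenspace b) :
    ⁅x, y⁆ ∈ g.maxGenEigenspace (a * b) := by
  rw [Module.End.mem_maxGenEigenspace] at hx hy ⊢
  obtain ⟨k, hk⟩ := hx
  obtain ⟨l, hl⟩ := hy
  have key : ∀ n k l : ℕ, k + l = n → ∀ x y : L, ((g - a • 1) ^ k) x = 0 →
      ((g - b • 1) ^ l) y = 0 → ((g - (a * b) • 1) ^ n) ⁅x, y⁆ = 0 := by
    intro n
    induction n with
    | zero =>
      intro k l h x y hx _
      obtain ⟨rfl, rfl⟩ : k = 0 ∧ l = 0 := by omega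
      have hx' : x = 0 := by simpa using hx
      simp [hx']
    | succ n ih =>
      intro k l h x y hx hy
      -- A twisted Leibniz rule: each term lowers one of the two nilpotency exponents, hence
      -- induction on their sum.
      have hstep : (g - (a * b) • 1) ⁅x, y⁆ =
          ⁅(g - a • 1) x, g y⁆ + ⁅a • x, (g - b • 1) y⁆ := by
        simp only [LinearMap.sub_apply, LinearMap.smul_apply, Module.End.one_apply, hg, sub_lie,
          lie_sub, smul_lie, lie_smul, mul_smul]
        module
      rw [pow_succ, Module.End.mul_apply, hstep, map_add]
      have h1 : ((g - (a * b) • 1) ^ n) ⁅(g - a • 1) x, g y⁆ = 0 := by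
        rcases k with _ | k
        · have hx' : x = 0 := by simpa using hx
          simp [hx']
        · refine ih k l (by omega) _ _ ?_ ?_
          · rwa [pow_succ, Module.End.mul_apply] at hx
          · have hc : Commute ((g - b • 1) ^ l) g :=
              ((Commute.refl g).sub_left ((Commute.one_left g).smul_left b)).pow_left l
            rw [← Module.End.mul_apply, hc.eq, Module.End.mul_apply, hy, map_zero]
      have h2 : ((g - (a * b) • 1) ^ n) ⁅a • x, (g - b • 1) y⁆ = 0 := by
        rcases l with _ | l
        · have hy' : y = 0 := by simpa using hy
          simp [hy']
        · refine ih k l (by omega) _ _ ?_ ?_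
          · rw [map_smul, hx, smul_zero]
          · rwa [pow_succ, Module.End.mul_apply] at hy
      rw [h1, h2, add_zero]
  exact ⟨k + l, key _ k l rfl x y hk hl⟩

/-- The generalized eigenspaces of `g` grade `L` by the group `ℂˣ`, so a multiplicative function of
the eigenvalue gives an endomorphism of the Lie algebra. -/
theorem map_lie_of_scalar_on_maxGenEigenspace [LieRing L] [LieAlgebra ℂ L]
    [FiniteDimensional ℂ L] {g T : Module.End ℂ L} (hg : ∀ x y, g ⁅x, y⁆ = ⁅g x, g y⁆)
    (hinj : Function.Injective g) {c : ℂ → ℂ}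
    (hc : ∀ a b, a ≠ 0 → b ≠ 0 → c (a * b) = c a * c b)
    (hT : ∀ a, ∀ x ∈ g.maxGenEigenspace a, T x = c a • x) (x y : L) :
    T ⁅x, y⁆ = ⁅T x, T y⁆ := by
  have h0 : ∀ x ∈ g.maxGenEigenspace 0, x = 0 := fun x hx => by
    rw [mem_maxGenEigenspace_iff_finrank, zero_smul, sub_zero, Module.End.coe_pow] at hx
    exact hinj.iterate _ (hx.trans (by rw [← Module.End.coe_pow, map_zero]))
  revert x
  refine maxGenEigenspace_induction g (fun a x hx => ?_) (by simp) fun x x' hx hx' => by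
    simp only [add_lie, map_add, hx, hx']
  revert y
  refine maxGenEigenspace_induction g (fun b y hy => ?_) (by simp) fun y y' hy hy' => by
    simp only [lie_add, map_add, hy, hy']
  rcases eq_or_ne a 0 with rfl | ha
  · simp [h0 x hx]
  rcases eq_or_ne b 0 with rfl | hb
  · simp [h0 y hy]
  rw [hT _ _ (lie_mem_maxGenEigenspace_of_map_lie hg hx hy), hT _ _ hx, hT _ _ hy, hc a b ha hb,
    smul_lie, lie_smul, mul_smul]

end GeneralizedEigenspaces

/-! ### Making the square of an antilinear automorphism of finite 2-power order. -/

section FiniteOrder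

open ComplexConjugate

/-- The square of an antilinear map, as a linear map. -/
def antilinearSq {M : Type*} [AddCommGroup M] [Module ℂ M] (φ : M →ₛₗ[starRingEnd ℂ] M) :
    Module.End ℂ M :=
  φ.comp φ

theorem antilinearSq_apply {M : Type*} [AddCommGroup M] [Module ℂ M]
    (φ : M →ₛₗ[starRingEnd ℂ] M) (x : M) : antilinearSq φ x = φ (φ x) := rfl

theorem map_antilinearSq {M : Type*} [AddCommGroup M] [Module ℂ M]
    (φ : M →ₛₗ[starRingEnd ℂ] M) (x : M) : φ (antilinearSq φ x) = antilinearSq φ (φ x) := rfl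

theorem map_antilinearSq_pow {M : Type*} [AddCommGroup M] [Module ℂ M]
    (φ : M →ₛₗ[starRingEnd ℂ] M) (n : ℕ) (x : M) :
    φ ((antilinearSq φ ^ n) x) = (antilinearSq φ ^ n) (φ x) := by
  induction n generalizing x with
  | zero => simp
  | succ n ih => rw [pow_succ, Module.End.mul_apply, ih, map_antilinearSq, Module.End.mul_apply]

variable {L : Type*} [LieRing L] [LieAlgebra ℂ L]

theorem antilinearSq_pow_lie {φ : L →ₛₗ[starRingEnd ℂ] L} (hφ : ∀ x y, φ ⁅x, y⁆ = ⁅φ x, φ y⁆)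
    (n : ℕ) (x y : L) :
    (antilinearSq φ ^ n) ⁅x, y⁆ = ⁅(antilinearSq φ ^ n) x, (antilinearSq φ ^ n) y⁆ := by
  induction n with
  | zero => simp
  | succ n ih => simp only [pow_succ', Module.End.mul_apply, ih, antilinearSq_apply, hφ]

theorem map_sub_smul_pow_antilinearSq (φ : L →ₛₗ[starRingEnd ℂ] L) (a : ℂ) (n : ℕ) (x : L) :
    φ (((antilinearSq φ - a • 1) ^ n) x) = ((antilinearSq φ - conj a • 1) ^ n) (φ x) := by
  induction n generalizing x with
  | zero => simp
  | succ n ih =>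
    rw [pow_succ, Module.End.mul_apply, ih, pow_succ, Module.End.mul_apply]
    congr 1
    simp [map_antilinearSq]

variable [FiniteDimensional ℂ L]

theorem map_mem_maxGenEigenspace_conj (φ : L →ₛₗ[starRingEnd ℂ] L) {a : ℂ} {x : L}
    (hx : x ∈ (antilinearSq φ).maxGenEigenspace a) :
    φ x ∈ (antilinearSq φ).maxGenEigenspace (conj a) := by
  rw [mem_maxGenEigenspace_iff_finrank] at hx ⊢
  rw [← map_sub_smul_pow_antilinearSq, hx, map_zero]

theorem apply_mem_maxGenEigenspace {M : Type*} [AddCommGroup M] [Module ℂ M] (g : Module.End ℂ M)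
    {A : Module.End ℂ M} (hA : Commute g A) {a : ℂ} {x : M} (hx : x ∈ g.maxGenEigenspace a) :
    A x ∈ g.maxGenEigenspace a :=
  Module.End.mapsTo_maxGenEigenspace_of_comm hA a hx

theorem commute_of_scalar_on_maxGenEigenspace {g T A : Module.End ℂ L} {c : ℂ → ℂ}
    (hT : ∀ a, ∀ x ∈ g.maxGenEigenspace a, T x = c a • x) (hA : Commute g A) : Commute T A :=
  linearMap_ext_maxGenEigenspace g fun a x hx => by
    rw [Module.End.mul_apply, Module.End.mul_apply, hT a x hx,
      hT a _ (apply_mem_maxGenEigenspace g hA hx), map_smul]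

/-- An antilinear automorphism can be corrected so that its square acts on every element with
finite order. -/
theorem exists_antilinear_locally_finite_order {φ : L →ₛₗ[starRingEnd ℂ] L}
    (hφ : ∀ x y, φ ⁅x, y⁆ = ⁅φ x, φ y⁆) (hinj : Function.Injective φ) :
    ∃ ψ : L →ₛₗ[starRingEnd ℂ] L, (∀ x y, ψ ⁅x, y⁆ = ⁅ψ x, ψ y⁆) ∧
      ∀ x, ∃ n, 0 < n ∧ (antilinearSq ψ ^ n) x = x := by
  set g := antilinearSq φ with hg
  have g_lie : ∀ x y, g ⁅x, y⁆ = ⁅g x, g y⁆ := fun x y => by simp only [hg, antilinearSq_apply, hφ]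
  have g_inj : Function.Injective g := hinj.comp hinj
  have h0 : ∀ x ∈ g.maxGenEigenspace 0, x = 0 := fun x hx => by
    rw [mem_maxGenEigenspace_iff_finrank, zero_smul, sub_zero, Module.End.coe_pow] at hx
    exact g_inj.iterate _ (hx.trans (by rw [← Module.End.coe_pow, map_zero]))
  obtain ⟨S, hS⟩ := exists_scalar_on_maxGenEigenspace g fun a => a⁻¹
  have S_lie := map_lie_of_scalar_on_maxGenEigenspace g_lie g_inj
    (fun a b _ _ => mul_inv a b) hS
  have gS : Commute g S := (commute_of_scalar_on_maxGenEigenspace hS (Commute.refl g)).symm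
  have φS : ∀ x, φ (S x) = S (φ x) :=
    maxGenEigenspace_induction g (fun a x hx => by
      rw [hS a x hx, map_smulₛₗ, hS _ _ (map_mem_maxGenEigenspace_conj φ hx), map_inv₀]) (by simp)
      fun x y hx hy => by simp only [map_add, hx, hy]
  -- `S` is the inverse of the semisimple part of `g`, so `S * g = 1 + N` is the unipotent factor.
  let N : Module.End ℂ L := S * g - 1
  have hN1 : 1 + N = S * g := by simp [N]
  have gN : Commute g N := (gS.mul_right (Commute.refl g)).sub_right (Commute.one_right g)
  have φN : ∀ x, φ (N x) = N (φ x) := fun x => by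
    simp only [N, LinearMap.sub_apply, Module.End.mul_apply, Module.End.one_apply, map_sub, φS]
    rw [hg, map_antilinearSq]
  set n := Module.finrank ℂ L
  have hN : N ^ n = 0 := linearMap_ext_maxGenEigenspace g fun a x hx => by
    rcases eq_or_ne a 0 with rfl | ha
    · rw [h0 x hx, map_zero, map_zero]
    have hk : ∀ k : ℕ, (N ^ k) x = (a⁻¹) ^ k • ((g - a • 1) ^ k) x := fun k => by
      induction k with
      | zero => simp
      | succ k ih =>
        have hmem : ((g - a • 1) ^ k) x ∈ g.maxGenEigenspace a :=
          apply_mem_maxGenEigenspace g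
            (((Commute.refl g).sub_right ((Commute.one_right g).smul_right a)).pow_right k) hx
        rw [pow_succ', Module.End.mul_apply, ih, map_smul, pow_succ' (g - a • 1),
          Module.End.mul_apply, pow_succ, mul_smul]
        congr 1
        set y := ((g - a • 1) ^ k) x
        simp only [N, LinearMap.sub_apply, Module.End.mul_apply, Module.End.one_apply,
          LinearMap.smul_apply]
        rw [hS a _ (apply_mem_maxGenEigenspace g (Commute.refl g) hmem), smul_sub,
          inv_smul_smul₀ ha]
    rw [hk, (mem_maxGenEigenspace_iff_finrank g a x).1 hx, smul_zero, LinearMap.zero_apply]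
  -- `w = (1 + N)^(-1/2)` commutes with `φ`, so `(φ w)² = g w²` is the semisimple part of `g`.
  let w := binomialPow n N (-(1 / 2))
  have w_lie : ∀ x y, w ⁅x, y⁆ = ⁅w x, w y⁆ := binomialPow_lie hN (fun x y => by
    rw [hN1, Module.End.mul_apply, g_lie, S_lie]; rfl) _
  have φw : ∀ x, φ (w x) = w (φ x) := fun x => by
    rw [map_binomialPow φN, map_neg, map_div₀, map_one, Complex.conj_ofNat]
  have gw : Commute g w := (binomialPow_comm n N gN.symm _).symm
  have hw : S * g * (w * w) = 1 := by
    rw [← binomialPow_add hN, ← hN1, ← pow_one (1 + N), ← binomialPow_natCast hN,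
      ← binomialPow_add hN, show ((1 : ℕ) : ℂ) + (-(1 / 2) + -(1 / 2)) = ((0 : ℕ) : ℂ) by norm_num,
      binomialPow_natCast hN, pow_zero]
  obtain ⟨f, hf, hfn⟩ := exists_multiplicative_root_of_unity_correction
  obtain ⟨T, hT⟩ := exists_scalar_on_maxGenEigenspace g f
  have T_lie := map_lie_of_scalar_on_maxGenEigenspace g_lie g_inj hf hT
  have Tw := commute_of_scalar_on_maxGenEigenspace hT gw
  refine ⟨φ.comp (T * w), fun x y => ?_, ?_⟩
  · simp only [LinearMap.comp_apply, Module.End.mul_apply, w_lie, T_lie, hφ]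
  -- The two occurrences of `T` act on the spaces for `a` and for `conj a`, because `φ` exchanges
  -- these; this is why the correction has the form `f a * conj (f (conj a))`.
  have hsq : ∀ a, ∀ x ∈ g.maxGenEigenspace a,
      antilinearSq (φ.comp (T * w)) x = (a * f a * conj (f (conj a))) • x := by
    intro a x hx
    rcases eq_or_ne a 0 with rfl | ha
    · simp [h0 x hx]
    have hwx : w (w x) ∈ g.maxGenEigenspace a :=
      apply_mem_maxGenEigenspace g gw (apply_mem_maxGenEigenspace g gw hx)
    have hgx : g (w (w x)) ∈ g.maxGenEigenspace a :=
      apply_mem_maxGenEigenspace g (Commute.refl g) hwx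
    have h1 : g (w (w x)) = a • x := by
      have := LinearMap.congr_fun hw x
      simp only [Module.End.mul_apply, Module.End.one_apply] at this
      rw [hS a _ hgx, inv_smul_eq_iff₀ ha] at this
      exact this
    have h2 : antilinearSq (φ.comp (T * w)) x = φ (T (w (φ (T (w x))))) := rfl
    have h3 : w (φ (T (w x))) = φ (T (w (w x))) := by
      rw [← φw, ← Module.End.mul_apply w T, ← Tw.eq, Module.End.mul_apply]
    rw [h2, h3, hT a _ hwx, map_smulₛₗ, map_smul, hT _ _ (map_mem_maxGenEigenspace_conj φ hwx),
      map_smulₛₗ, map_smulₛₗ, ← antilinearSq_apply, ← hg, h1, Complex.conj_conj, smul_smul, smul_smul]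
    congr 1
    ring
  have hpow : ∀ (ψ : Module.End ℂ L) (x : L) (n m : ℕ), (ψ ^ n) x = x → (ψ ^ (n * m)) x = x := by
    intro ψ x n m h
    rw [pow_mul]
    induction m with
    | zero => simp
    | succ m ih => rw [pow_succ, Module.End.mul_apply, h, ih]
  refine maxGenEigenspace_induction g (fun a x hx => ?_) ⟨1, one_pos, map_zero _⟩ ?_
  · rcases eq_or_ne a 0 with rfl | ha
    · exact ⟨1, one_pos, by simp [h0 x hx]⟩
    obtain ⟨m, hm, h1⟩ := hfn a ha
    refine ⟨m, hm, ?_⟩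
    have : ∀ m : ℕ, (antilinearSq (φ.comp (T * w)) ^ m) x =
        (a * f a * conj (f (conj a))) ^ m • x := fun m => by
      induction m with
      | zero => simp
      | succ m ih => rw [pow_succ', Module.End.mul_apply, ih, map_smul, hsq a x hx, pow_succ,
        smul_smul]
    rw [this, h1, one_smul]
  · rintro x y ⟨m, hm, hx⟩ ⟨l, hl, hy⟩
    refine ⟨m * l, by positivity, ?_⟩
    rw [map_add, hpow _ _ _ _ hx, mul_comm, hpow _ _ _ _ hy]

theorem exists_antilinear_two_power_order {φ : L →ₛₗ[starRingEnd ℂ] L}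
    (hφ : ∀ x y, φ ⁅x, y⁆ = ⁅φ x, φ y⁆) (hinj : Function.Injective φ) :
    ∃ ψ : L →ₛₗ[starRingEnd ℂ] L, (∀ x y, ψ ⁅x, y⁆ = ⁅ψ x, ψ y⁆) ∧
      ∃ k : ℕ, antilinearSq ψ ^ 2 ^ k = 1 := by
  obtain ⟨ψ, hψ, hfin⟩ := exists_antilinear_locally_finite_order hφ hinj
  set g := antilinearSq ψ with hg
  choose n hn hgn using hfin
  let b := Module.finBasis ℂ L
  let m := ∏ i, n (b i)
  have hm : m ≠ 0 := Finset.prod_ne_zero_iff.2 fun i _ => (hn _).ne'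
  have hgm : g ^ m = 1 := b.ext fun i => by
    obtain ⟨l, hl⟩ : n (b i) ∣ m := Finset.dvd_prod_of_mem _ (Finset.mem_univ i)
    rw [hl, pow_mul]
    generalize l = l
    induction l with
    | zero => simp
    | succ l ih => rw [pow_succ, Module.End.mul_apply, hgn, ih]
  -- Composing `ψ` with `g ^ j` replaces `g` by `g ^ (2 * j + 1)`, which kills the odd part of the
  -- order.
  obtain ⟨k, q, ⟨j, rfl⟩, hkq⟩ := Nat.exists_eq_two_pow_mul_odd hm
  refine ⟨ψ.comp (g ^ j), fun x y => ?_, k, ?_⟩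
  · rw [LinearMap.comp_apply, antilinearSq_pow_lie hψ, hψ]; rfl
  · have : antilinearSq (ψ.comp (g ^ j)) = g ^ (2 * j + 1) := LinearMap.ext fun x => by
      change ψ ((g ^ j) (ψ ((g ^ j) x))) = _
      rw [hg, map_antilinearSq_pow, ← antilinearSq_apply ψ, ← hg, ← Module.End.mul_apply,
        ← Module.End.mul_apply]
      congr 1
      rw [mul_assoc, ← pow_succ', ← pow_add]
      congr 1; omega
    rw [this, ← pow_mul, mul_comm, ← hkq, hgm]

end FiniteOrder

/-! ### Linear algebra of antilinear maps. -/

section LinearAlgebra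

open ComplexConjugate

theorem exists_pair_span_of_finrank_le_two {V : Type*} [AddCommGroup V] [Module ℂ V]
    [FiniteDimensional ℂ V] (h : Module.finrank ℂ V ≤ 2) :
    ∃ a b : V, ∀ v, ∃ s t : ℂ, v = s • a + t • b := by
  rcases (by omega : Module.finrank ℂ V = 0 ∨ Module.finrank ℂ V = 1 ∨ Module.finrank ℂ V = 2)
    with h | h | h
  · have := Module.finrank_zero_iff.1 h
    exact ⟨0, 0, fun v => ⟨0, 0, Subsingleton.elim _ _⟩⟩
  · let b := Module.finBasisOfFinrankEq ℂ V h
    refine ⟨b 0, 0, fun v => ⟨b.repr v 0, 0, ?_⟩⟩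
    conv_lhs => rw [← b.sum_repr v]
    simp
  · let b := Module.finBasisOfFinrankEq ℂ V h
    refine ⟨b 0, b 1, fun v => ⟨b.repr v 0, b.repr v 1, ?_⟩⟩
    rw [← Fin.sum_univ_two (fun i => b.repr v i • b i), b.sum_repr]

theorem exists_eigenvector_mem {V : Type*} [AddCommGroup V] [Module ℂ V] [FiniteDimensional ℂ V]
    (g : Module.End ℂ V) (U : Submodule ℂ V) (hU : U ≠ ⊥) (hg : ∀ x ∈ U, g x ∈ U) :
    ∃ x ∈ U, x ≠ 0 ∧ ∃ a : ℂ, g x = a • x := by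
  have : Nontrivial U := Submodule.nontrivial_iff_ne_bot.2 hU
  obtain ⟨a, ha⟩ := Module.End.exists_eigenvalue (g.restrict hg)
  obtain ⟨x, hx⟩ := ha.exists_hasEigenvector
  exact ⟨x, x.2, fun h => hx.2 (Subtype.ext h), a, congrArg Subtype.val hx.apply_eq_smul⟩

theorem pow_apply_of_apply_eq_smul {V : Type*} [AddCommGroup V] [Module ℂ V]
    {g : Module.End ℂ V} {x : V} {a : ℂ} (h : g x = a • x) (n : ℕ) : (g ^ n) x = a ^ n • x := by
  induction n with
  | zero => simp
  | succ n ih => rw [pow_succ', Module.End.mul_apply, ih, map_smul, h, smul_smul, pow_succ]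

/-- If `φ x = c • x`, then `a = |c|²` is a nonnegative real of norm 1. -/
theorem linearIndependent_pair_antilinear {V : Type*} [AddCommGroup V] [Module ℂ V]
    {φ : V →ₛₗ[starRingEnd ℂ] V} {x : V} {a : ℂ} (hx : x ≠ 0) (h : φ (φ x) = a • x)
    (hnorm : ‖a‖ = 1) (ha : a ≠ 1) : LinearIndependent ℂ ![x, φ x] := by
  rw [LinearIndependent.pair_iff' hx]
  intro c hc
  have h1 : φ (φ x) = (conj c * c) • x := by
    rw [← hc, map_smulₛₗ, ← hc, smul_smul]
  rw [h] at h1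
  have h2 : a = conj c * c := smul_left_injective ℂ hx h1
  apply ha
  rw [h2, ← Complex.normSq_eq_conj_mul_self] at hnorm ⊢
  rw [Complex.norm_real, Real.norm_of_nonneg (Complex.normSq_nonneg c)] at hnorm
  rw [hnorm, Complex.ofReal_one]

theorem exists_eq_add_of_finrank_le_two {V : Type*} [AddCommGroup V] [Module ℂ V]
    [FiniteDimensional ℂ V] {U : Submodule ℂ V} (hU : Module.finrank ℂ U ≤ 2) {x y : V}
    (hx : x ∈ U) (hy : y ∈ U) (h : LinearIndependent ℂ ![x, y]) {v : V} (hv : v ∈ U) :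
    ∃ s t : ℂ, v = s • x + t • y := by
  have hle : Submodule.span ℂ {x, y} ≤ U := by
    rw [Submodule.span_le]
    rintro _ (rfl | rfl)
    exacts [hx, hy]
  have h2 : Module.finrank ℂ (Submodule.span ℂ {x, y}) = 2 := by
    have := finrank_span_eq_card h
    rwa [Matrix.range_cons_cons_empty, Fintype.card_fin] at this
  rw [← Submodule.eq_of_le_of_finrank_le hle (by omega), Submodule.mem_span_pair] at hv
  obtain ⟨s, t, h⟩ := hv
  exact ⟨s, t, h.symm⟩

theorem exists_antilinear_involution_of_abelian {L : Type*} [LieRing L] [LieAlgebra ℂ L]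
    [FiniteDimensional ℂ L] (h : ∀ x y : L, ⁅x, y⁆ = 0) :
    ∃ τ : L →ₛₗ[starRingEnd ℂ] L, (∀ x y, τ ⁅x, y⁆ = ⁅τ x, τ y⁆) ∧ ∀ x, τ (τ x) = x := by
  let b := Module.finBasis ℂ L
  let τ : L →ₛₗ[starRingEnd ℂ] L :=
    { toFun := fun x => ∑ i, conj (b.repr x i) • b i
      map_add' := fun x y => by simp [add_smul, Finset.sum_add_distrib]
      map_smul' := fun c x => by simp [mul_smul, Finset.smul_sum] }
  have hb : ∀ i, τ (b i) = b i := fun i => by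
    change ∑ j, conj (b.repr (b i) j) • b j = b i
    rw [Finset.sum_eq_single i] <;> simp +contextual [eq_comm]
  refine ⟨τ, fun x y => by rw [h, h, map_zero], fun x => ?_⟩
  change τ (∑ i, conj (b.repr x i) • b i) = x
  simp only [map_sum, map_smulₛₗ, hb, Complex.conj_conj]
  exact b.sum_repr x

end LinearAlgebra

/-! ### Rescaling to an involution, and a forced abelian case. -/

section LowDimension

variable {L : Type*} [LieRing L] [LieAlgebra ℂ L]

/-- All brackets are multiples of the bracket of two spanning vectors, so the derived algebra is
abelian. -/
theorem isSolvable_of_finrank_le_two [FiniteDimensional ℂ L] (h : Module.finrank ℂ L ≤ 2) :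
    LieAlgebra.IsSolvable L := by
  obtain ⟨a, b, hab⟩ := exists_pair_span_of_finrank_le_two h
  have hspan : ∀ x ∈ LieAlgebra.derivedSeries ℂ L 1, ∃ c : ℂ, x = c • ⁅a, b⁆ := by
    intro x hx
    have hx : x ∈ Submodule.span ℂ {m : L | ∃ x y : L, ⁅x, y⁆ = m} := by
      rwa [← LieAlgebra.coe_derivedSeries_one_eq]
    suffices Submodule.span ℂ {m : L | ∃ x y : L, ⁅x, y⁆ = m} ≤ Submodule.span ℂ {⁅a, b⁆} by
      obtain ⟨c, hc⟩ := Submodule.mem_span_singleton.1 (this hx)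
      exact ⟨c, hc.symm⟩
    rw [Submodule.span_le]
    rintro _ ⟨x, y, rfl⟩
    obtain ⟨s, t, rfl⟩ := hab x
    obtain ⟨s', t', rfl⟩ := hab y
    refine Submodule.mem_span_singleton.2 ⟨s * t' - t * s', ?_⟩
    simp only [add_lie, lie_add, smul_lie, lie_smul, lie_self, ← lie_skew b a]
    module
  refine LieAlgebra.IsSolvable.mk (R := ℂ) (k := 2) ?_
  rw [LieAlgebra.derivedSeries_def, LieAlgebra.derivedSeriesOfIdeal_succ,
    LieSubmodule.lie_eq_bot_iff]
  intro x hx y hy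
  obtain ⟨c, rfl⟩ := hspan x hx
  obtain ⟨d, rfl⟩ := hspan y hy
  simp

/-- Lie's theorem for the solvable algebra `P` acting on `Q`. -/
theorem exists_common_eigenvector_mem [FiniteDimensional ℂ L] (P : LieSubalgebra ℂ L)
    (hP : Module.finrank ℂ P ≤ 2) (Q : Submodule ℂ L) (hQ : Q ≠ ⊥)
    (hPQ : ∀ v ∈ P, ∀ q ∈ Q, ⁅v, q⁆ ∈ Q) :
    ∃ y ∈ Q, y ≠ 0 ∧ ∀ v ∈ P, ∃ c : ℂ, ⁅v, y⁆ = c • y := by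
  have := isSolvable_of_finrank_le_two hP
  let Q' : LieSubmodule ℂ P L := { Q with lie_mem := fun {v q} hq => hPQ v v.2 q hq }
  have : Nontrivial Q' := Submodule.nontrivial_iff_ne_bot.2 hQ
  obtain ⟨χ, hχ⟩ := LieModule.exists_nontrivial_weightSpace_of_isSolvable ℂ P Q'
  obtain ⟨⟨y, hy⟩, hy0⟩ := exists_ne (0 : LieModule.weightSpace Q' χ)
  rw [LieModule.mem_weightSpace] at hy
  refine ⟨y, y.2, fun h => hy0 (Subtype.ext (Subtype.ext h)), fun v hv => ⟨χ ⟨v, hv⟩, ?_⟩⟩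
  exact congrArg Subtype.val (hy ⟨v, hv⟩)

open ComplexConjugate

/-- With `c² = a`, let `S` be 1 on `P`, `conj c` on `y` and `c` on `φ y`. It is an automorphism
since `P` acts diagonally on `y`, `φ y` and `⁅y, φ y⁆` is scaled by `|c|² = 1`; the involution is `φ
∘ S`. -/
theorem exists_antilinear_involution_of_adapted {φ : L →ₛₗ[starRingEnd ℂ] L}
    (hφ : ∀ x y, φ ⁅x, y⁆ = ⁅φ x, φ y⁆) (P : LieSubalgebra ℂ L) (hφP : ∀ v ∈ P, φ v ∈ P)
    (hφφ : ∀ v ∈ P, φ (φ v) = v) {y : L} {a : ℂ} (hy : φ (φ y) = a • y) (ha : ‖a‖ = 1)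
    (hPy : ∀ v ∈ P, ∃ c : ℂ, ⁅v, y⁆ = c • y) (hyy : ⁅y, φ y⁆ ∈ P)
    (h1 : y ∉ P.toSubmodule ⊔ Submodule.span ℂ {φ y})
    (h2 : φ y ∉ P.toSubmodule ⊔ Submodule.span ℂ {y})
    (hdec : ∀ x, ∃ v ∈ P, ∃ s t : ℂ, x = v + (s • y + t • φ y)) :
    ∃ τ : L →ₛₗ[starRingEnd ℂ] L, (∀ x y, τ ⁅x, y⁆ = ⁅τ x, τ y⁆) ∧ ∀ x, τ (τ x) = x := by
  obtain ⟨c, hc⟩ : ∃ c : ℂ, c ^ 2 = a := IsAlgClosed.exists_pow_nat_eq a two_pos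
  have hcn : ‖c‖ = 1 := by
    rw [← hc, norm_pow] at ha
    exact (pow_eq_one_iff_of_nonneg (norm_nonneg c) two_ne_zero).1 ha
  have hcc : conj c * c = 1 := by
    rw [← Complex.normSq_eq_conj_mul_self, Complex.normSq_eq_norm_sq, hcn]; simp
  -- Coordinate functionals for `y` and `φ y`, used to write `S` as a linear map.
  have functional : ∀ {x z : L}, x ∉ P.toSubmodule ⊔ Submodule.span ℂ {z} →
      ∃ f : L →ₗ[ℂ] ℂ, (∀ v ∈ P, f v = 0) ∧ f z = 0 ∧ f x = 1 := by
    intro x z h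
    obtain ⟨f, hf, hker⟩ := Submodule.exists_le_ker_of_notMem h
    refine ⟨(f x)⁻¹ • f, fun v hv => ?_, ?_, by simp [hf]⟩
    · have : f v = 0 := hker (Submodule.mem_sup_left hv)
      simp [this]
    · have : f z = 0 := hker (Submodule.mem_sup_right (Submodule.mem_span_singleton_self z))
      simp [this]
  obtain ⟨α, αP, αφ, αy⟩ := functional h1
  obtain ⟨β, βP, βy, βφ⟩ := functional h2
  let S : Module.End ℂ L :=
    1 + (conj c - 1) • α.smulRight y + (c - 1) • β.smulRight (φ y)
  have S_apply : ∀ x, S x = x + (conj c - 1) • α x • y + (c - 1) • β x • φ y := fun x => rfl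
  have SP : ∀ v ∈ P, S v = v := fun v hv => by simp [S_apply, αP v hv, βP v hv]
  have Sy : S y = conj c • y := by rw [S_apply, αy, βy]; module
  have Sφ : S (φ y) = c • φ y := by rw [S_apply, αφ, βφ]; module
  have hPφ : ∀ v ∈ P, ∃ d : ℂ, ⁅v, φ y⁆ = d • φ y := fun v hv => by
    obtain ⟨d, hd⟩ := hPy (φ v) (hφP v hv)
    refine ⟨conj d, ?_⟩
    rw [← map_smulₛₗ, ← hd, hφ, hφφ v hv]
  have S_lie : ∀ x z, S ⁅x, z⁆ = ⁅S x, S z⁆ := by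
    intro x z
    obtain ⟨v, hv, s, t, rfl⟩ := hdec x
    obtain ⟨w, hw, s', t', rfl⟩ := hdec z
    obtain ⟨d, hd⟩ := hPy v hv
    obtain ⟨e, he⟩ := hPφ v hv
    obtain ⟨d', hd'⟩ := hPy w hw
    obtain ⟨e', he'⟩ := hPφ w hw
    have hd2 : ⁅y, w⁆ = -(d' • y) := by rw [← lie_skew, hd']
    have he2 : ⁅φ y, w⁆ = -(e' • φ y) := by rw [← lie_skew, he']
    have hsk : ⁅φ y, y⁆ = -⁅y, φ y⁆ := (lie_skew _ _).symm
    simp only [add_lie, lie_add, smul_lie, lie_smul, lie_self, hd, he, hd2, he2, hsk, map_add,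
      map_smul, map_neg, SP _ hv, SP _ hw, SP _ hyy, SP _ (P.lie_mem hv hw), Sy, Sφ, smul_zero,
      add_zero, zero_add, smul_neg]
    match_scalars
    all_goals first | ring1 | linear_combination (s' * t - t' * s) * hcc
  refine ⟨φ.comp S, fun x z => ?_, fun x => ?_⟩
  · rw [LinearMap.comp_apply, S_lie, hφ]; rfl
  · obtain ⟨v, hv, s, t, rfl⟩ := hdec x
    have e1 : φ (S (φ (S y))) = y := by
      rw [Sy, map_smulₛₗ, Complex.conj_conj, map_smul, Sφ, map_smulₛₗ, map_smulₛₗ, hy, smul_smul,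
        smul_smul, ← hc, show conj c * conj c * c ^ 2 = (conj c * c) ^ 2 by ring, hcc, one_pow,
        one_smul]
    have e2 : φ (S (φ (S (φ y)))) = φ y := by
      rw [Sφ, map_smulₛₗ φ c, hy, smul_smul, map_smul, Sy, smul_smul, map_smulₛₗ, ← hc, map_mul,
        map_mul, map_pow, Complex.conj_conj, show c * conj c ^ 2 * c = (conj c * c) ^ 2 by ring,
        hcc, one_pow, one_smul]
    simp only [LinearMap.comp_apply, map_add, map_smulₛₗ, Complex.conj_conj, e1, e2,
      SP _ hv, SP _ (hφP _ hv), hφφ _ hv]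

/-- As `x` and `φ x` commute, so do their adjoint actions; on `y` this reads `|t|² = |s|² a²`.
Taking norms gives `|t| = |s|`, and `a² ≠ 1` then forces `s = t = 0`. -/
theorem abelian_of_adapted {φ : L →ₛₗ[starRingEnd ℂ] L} (hφ : ∀ x y, φ ⁅x, y⁆ = ⁅φ x, φ y⁆)
    {x y : L} {a s t : ℂ} (hy0 : y ≠ 0) (hy : φ (φ y) = a • y)
    (ha : ‖a‖ = 1) (ha2 : a ^ 2 ≠ 1) (hxx : ⁅x, φ x⁆ = 0) (hyy : ⁅y, φ y⁆ = 0)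
    (hs : ⁅x, y⁆ = s • φ y) (ht : ⁅x, φ y⁆ = t • y)
    (hdec : ∀ z, ∃ p q r w : ℂ, z = (p • x + q • φ x) + (r • y + w • φ y)) (z z' : L) :
    ⁅z, z'⁆ = 0 := by
  have ha0 : a ≠ 0 := by rintro rfl; simp at ha
  have h1 : ⁅φ x, φ y⁆ = (conj s * a) • y := by rw [← hφ, hs, map_smulₛₗ, hy, smul_smul]
  have h2 : ⁅φ x, y⁆ = (a⁻¹ * conj t) • φ y := by
    have : a • ⁅φ x, y⁆ = conj t • φ y := by rw [← lie_smul, ← hy, ← hφ, ht, map_smulₛₗ]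
    rw [mul_smul, ← this, inv_smul_smul₀ ha0]
  have hcomm : ⁅x, ⁅φ x, y⁆⁆ = ⁅φ x, ⁅x, y⁆⁆ := by
    rw [leibniz_lie, hxx, zero_lie, zero_add]
  rw [h2, hs, lie_smul, lie_smul, ht, h1, smul_smul, smul_smul] at hcomm
  have hst : a⁻¹ * conj t * t = s * (conj s * a) := smul_left_injective ℂ hy0 hcomm
  have hN : (Complex.normSq t : ℂ) = Complex.normSq s * a ^ 2 := by
    rw [Complex.normSq_eq_conj_mul_self, Complex.normSq_eq_conj_mul_self]
    have : a * (a⁻¹ * conj t * t) = a * (s * (conj s * a)) := by rw [hst]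
    rw [mul_assoc a⁻¹, mul_inv_cancel_left₀ ha0] at this
    rw [this]; ring
  have hNr : Complex.normSq t = Complex.normSq s := by
    have := congrArg norm hN
    rwa [norm_mul, norm_pow, ha, one_pow, mul_one, Complex.norm_real, Complex.norm_real,
      Real.norm_of_nonneg (Complex.normSq_nonneg _),
      Real.norm_of_nonneg (Complex.normSq_nonneg _)] at this
  have hs0 : s = 0 := by
    by_contra h
    rw [hNr] at hN
    have h' : (Complex.normSq s : ℂ) ≠ 0 := by simpa using h
    exact ha2 (mul_left_cancel₀ h' (by rw [← hN, mul_one]))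
  have ht0 : t = 0 := by simpa [hs0] using hNr
  rw [ht0, zero_smul] at ht
  rw [hs0, zero_smul] at hs
  rw [hs0, map_zero, zero_mul, zero_smul] at h1
  rw [ht0, map_zero, mul_zero, zero_smul] at h2
  have sk : ∀ {u v : L}, ⁅u, v⁆ = 0 → ⁅v, u⁆ = 0 := fun {u v} h => by rw [← lie_skew, h, neg_zero]
  obtain ⟨p, q, r, w, rfl⟩ := hdec z
  obtain ⟨p', q', r', w', rfl⟩ := hdec z'
  simp only [add_lie, lie_add, smul_lie, lie_smul, lie_self, hs, ht, h1, h2, hxx, hyy, sk hs,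
    sk ht, sk h1, sk h2, sk hxx, sk hyy, smul_zero, add_zero]

end LowDimension

/-! ### Descent to an involution in dimension at most 4. -/

section RealForms

open ComplexConjugate

variable {L : Type*} [LieRing L] [LieAlgebra ℂ L] [FiniteDimensional ℂ L]

/-- On `Q` modulo the `φ`-stable plane of `y`, `φ y`, a line spanned by `v` cannot be `φ`-stable:
`φ²` would act on it by `|c|²`, while its `n`-th power acts by `-1`. Hence `v` and `φ v` add two
more dimensions. -/
theorem four_le_finrank_of_antilinear {V : Type*} [AddCommGroup V] [Module ℂ V]
    [FiniteDimensional ℂ V] {φ : V →ₛₗ[starRingEnd ℂ] V} {Q : Submodule ℂ V}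
    (hφQ : ∀ q ∈ Q, φ q ∈ Q) {n : ℕ} (hQ : ∀ q ∈ Q, (antilinearSq φ ^ n) q = -q)
    {y : V} {a : ℂ} (hyQ : y ∈ Q) (hy : φ (φ y) = a • y)
    (hli : LinearIndependent ℂ ![y, φ y]) {v : V} (hvQ : v ∈ Q)
    (hv : v ∉ Submodule.span ℂ {y, φ y}) : 4 ≤ Module.finrank ℂ Q := by
  set W := Submodule.span ℂ {y, φ y} with hW
  have hφW : ∀ w ∈ W, φ w ∈ W := fun w hw => by
    obtain ⟨s, t, rfl⟩ := Submodule.mem_span_pair.1 hw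
    rw [map_add, map_smulₛₗ, map_smulₛₗ, hy, smul_smul]
    exact Submodule.mem_span_pair.2 ⟨conj t * a, conj s, add_comm _ _⟩
  have hW2 : Module.finrank ℂ W = 2 := by
    have := finrank_span_eq_card hli
    rwa [Matrix.range_cons_cons_empty, Fintype.card_fin] at this
  have hWQ : W ≤ Q := by
    rw [hW, Submodule.span_le]
    rintro _ (rfl | rfl)
    exacts [hyQ, hφQ _ hyQ]
  have hφv : φ v ∉ W ⊔ Submodule.span ℂ {v} := by
    intro h
    obtain ⟨w, hw, u, hu, hwu⟩ := Submodule.mem_sup.1 h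
    obtain ⟨c, rfl⟩ := Submodule.mem_span_singleton.1 hu
    have hstep : ∀ m : ℕ, ∃ w ∈ W, (antilinearSq φ ^ m) v = w + ((Complex.normSq c : ℂ) ^ m) • v := by
      intro m
      induction m with
      | zero => exact ⟨0, W.zero_mem, by simp⟩
      | succ m ih =>
        obtain ⟨w', hw', h'⟩ := ih
        refine ⟨φ (φ w') + (Complex.normSq c : ℂ) ^ m • (φ w + conj c • w),
          W.add_mem (hφW _ (hφW _ hw')) (W.smul_mem _ (W.add_mem (hφW _ hw) (W.smul_mem _ hw))), ?_⟩
        have hgv : φ (φ v) = (φ w + conj c • w) + (Complex.normSq c : ℂ) • v := by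
          rw [Complex.normSq_eq_conj_mul_self, mul_smul, ← hwu, map_add, map_smulₛₗ, ← hwu]
          module
        rw [pow_succ', Module.End.mul_apply, h', map_add, map_smul, antilinearSq_apply,
          antilinearSq_apply, hgv, pow_succ]
        module
    obtain ⟨w', hw', h'⟩ := hstep n
    rw [hQ v hvQ] at h'
    have hne : (1 + (Complex.normSq c : ℂ) ^ n) ≠ 0 := by
      have : (0 : ℝ) < 1 + Complex.normSq c ^ n := by
        have := pow_nonneg (Complex.normSq_nonneg c) n
        linarith
      exact_mod_cast this.ne'
    apply hv
    have h2 : (1 + (Complex.normSq c : ℂ) ^ n) • v = -w' := by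
      rw [add_smul, one_smul, eq_neg_iff_add_eq_zero]
      rw [add_assoc, add_comm _ w', ← h', add_neg_cancel]
    rw [← inv_smul_smul₀ hne v, h2]
    exact W.smul_mem _ (W.neg_mem hw')
  have h1 : W < W ⊔ Submodule.span ℂ {v} := by
    refine lt_of_le_of_ne le_sup_left fun h => hv ?_
    rw [h]
    exact Submodule.mem_sup_right (Submodule.mem_span_singleton_self v)
  have h2 : W ⊔ Submodule.span ℂ {v} < Q := by
    refine lt_of_le_of_ne (sup_le hWQ ?_) fun h => hφv ?_
    · rwa [Submodule.span_singleton_le_iff_mem]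
    · rw [h]
      exact hφQ v hvQ
  have := Submodule.finrank_lt_finrank_of_lt h1
  have := Submodule.finrank_lt_finrank_of_lt h2
  omega

/-- The eigenvector is sought in the image of `g - 1`. Eigenvalue 1 there would give a Jordan block,
`g ^ n u = u + n x`, contradicting finite order. -/
theorem exists_eigenvector_of_ne_one {V : Type*} [AddCommGroup V] [Module ℂ V]
    [FiniteDimensional ℂ V] {g : Module.End ℂ V} {P : Submodule ℂ V} (hgP : ∀ v ∈ P, g v ∈ P)
    {n : ℕ} (hn : n ≠ 0) (hg : ∀ v ∈ P, (g ^ n) v = v) {p : V} (hp : p ∈ P) (hgp : g p ≠ p) :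
    ∃ x ∈ P, x ≠ 0 ∧ ∃ a : ℂ, a ≠ 1 ∧ g x = a • x := by
  obtain ⟨x, hx, hx0, a, hax⟩ := exists_eigenvector_mem g (P.map (g - 1))
    (fun h => hgp (by
      have : (g - 1) p ∈ P.map (g - 1) := Submodule.mem_map_of_mem hp
      rw [h, Submodule.mem_bot, LinearMap.sub_apply, sub_eq_zero] at this
      exact this))
    (by
      rintro _ ⟨u, hu, rfl⟩
      exact ⟨g u, hgP u hu, by simp⟩)
  obtain ⟨u, hu, rfl⟩ := hx
  set x := (g - 1) u with hxu
  refine ⟨x, P.sub_mem (hgP u hu) hu, hx0, a, ?_, hax⟩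
  rintro rfl
  rw [one_smul] at hax
  have hgu : g u = u + x := by simp [hxu]
  have hm : ∀ m : ℕ, (g ^ m) u = u + (m : ℂ) • x := fun m => by
    induction m with
    | zero => simp
    | succ m ih =>
      rw [pow_succ', Module.End.mul_apply, ih, map_add, map_smul, hax, hgu]
      push_cast
      module
  have := hm n
  rw [hg u hu, left_eq_add, smul_eq_zero, Nat.cast_eq_zero] at this
  exact this.elim hn hx0

/-- The induction only lowers the exponent until `θ = g ^ 2 ^ k` is nontrivial; the grading `L = P ⊕
Q` by `θ` then settles the matter directly. -/
theorem exists_antilinear_involution_of_two_power_order (hdim : Module.finrank ℂ L ≤ 4) (k : ℕ) :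
    ∀ φ : L →ₛₗ[starRingEnd ℂ] L, (∀ x y, φ ⁅x, y⁆ = ⁅φ x, φ y⁆) →
      antilinearSq φ ^ 2 ^ k = 1 →
      ∃ τ : L →ₛₗ[starRingEnd ℂ] L, (∀ x y, τ ⁅x, y⁆ = ⁅τ x, τ y⁆) ∧ ∀ x, τ (τ x) = x := by
  induction k with
  | zero =>
    intro φ hφ h
    rw [pow_zero, pow_one] at h
    exact ⟨φ, hφ, fun x => LinearMap.congr_fun h x⟩
  | succ k ih =>
  intro φ hφ hpow
  by_cases hθ1 : antilinearSq φ ^ 2 ^ k = 1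
  · exact ih φ hφ hθ1
  by_cases hab : ∀ x y : L, ⁅x, y⁆ = 0
  · exact exists_antilinear_involution_of_abelian hab
  set g := antilinearSq φ with hg
  have hgφ : ∀ x, g x = φ (φ x) := fun x => rfl
  have g_lie : ∀ x y, g ⁅x, y⁆ = ⁅g x, g y⁆ := fun x y => by simp only [hgφ, hφ]
  set θ := g ^ 2 ^ k with hθ
  have θθ : ∀ x, θ (θ x) = x := fun x => by
    rw [← Module.End.mul_apply, hθ, ← pow_add, ← two_mul, ← pow_succ', hpow, Module.End.one_apply]
  have θ_lie : ∀ x y, θ ⁅x, y⁆ = ⁅θ x, θ y⁆ := antilinearSq_pow_lie hφ _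
  have φθ : ∀ x, φ (θ x) = θ (φ x) := map_antilinearSq_pow φ _
  have hnorm : ∀ {x : L} {a : ℂ}, x ≠ 0 → g x = a • x → ‖a‖ = 1 := by
    intro x a hx0 h
    have h1 := pow_apply_of_apply_eq_smul h (2 ^ (k + 1))
    rw [hpow, Module.End.one_apply] at h1
    exact Complex.norm_eq_one_of_pow_eq_one
      (smul_left_injective ℂ hx0 (by simpa using h1.symm)) (by positivity)
  -- the fixed points of `θ` and its `-1`-eigenspace
  let P : LieSubalgebra ℂ L :=
    { LinearMap.ker (θ - 1) with
      lie_mem' := fun {x y} hx hy => by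
        have hx' : θ x = x := sub_eq_zero.1 hx
        have hy' : θ y = y := sub_eq_zero.1 hy
        have : θ ⁅x, y⁆ = ⁅x, y⁆ := by rw [θ_lie, hx', hy']
        exact sub_eq_zero.2 this }
  let Q : Submodule ℂ L := LinearMap.ker (θ + 1)
  have hP : ∀ x, x ∈ P ↔ θ x = x := fun x => sub_eq_zero
  have hQ : ∀ x, x ∈ Q ↔ θ x = -x := fun x => eq_neg_iff_add_eq_zero.symm
  have hφP : ∀ v ∈ P, φ v ∈ P := fun v hv => by rw [hP] at *; rw [← φθ, hv]
  have hφQ : ∀ v ∈ Q, φ v ∈ Q := fun v hv => by rw [hQ] at *; rw [← φθ, hv, map_neg]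
  have hPQ : ∀ v ∈ P, ∀ q ∈ Q, ⁅v, q⁆ ∈ Q := fun v hv q hq => by
    rw [hP] at hv; rw [hQ] at *; rw [θ_lie, hv, hq, lie_neg]
  have hQQ : ∀ v ∈ Q, ∀ q ∈ Q, ⁅v, q⁆ ∈ P := fun v hv q hq => by
    rw [hQ] at hv hq; rw [hP, θ_lie, hv, hq, lie_neg, neg_lie, neg_neg]
  have hdec : ∀ x, ∃ v ∈ P, ∃ q ∈ Q, x = v + q := fun x => by
    refine ⟨(2⁻¹ : ℂ) • (x + θ x), ?_, (2⁻¹ : ℂ) • (x - θ x), ?_, by module⟩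
    · rw [hP, map_smul, map_add, θθ, add_comm]
    · rw [hQ, map_smul, map_sub, θθ, ← smul_neg, neg_sub]
  have hPQ0 : ∀ x ∈ P, x ∈ Q → x = 0 := fun x h1 h2 => by
    rw [hP] at h1; rw [hQ, h1] at h2
    rw [eq_neg_iff_add_eq_zero, ← two_smul ℂ] at h2
    exact (smul_eq_zero.1 h2).resolve_left two_ne_zero
  have hcompl : IsCompl P.toSubmodule Q := by
    refine ⟨Submodule.disjoint_def.2 hPQ0, codisjoint_iff.2 (eq_top_iff.2 fun x _ => ?_)⟩
    obtain ⟨v, hv, q, hq, rfl⟩ := hdec x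
    exact Submodule.add_mem_sup hv hq
  have hrank : Module.finrank ℂ P.toSubmodule + Module.finrank ℂ Q = Module.finrank ℂ L :=
    Submodule.finrank_add_eq_of_isCompl hcompl
  have hQ0 : Q ≠ ⊥ := fun h => hθ1 <| LinearMap.ext fun x => by
    obtain ⟨v, hv, q, hq, rfl⟩ := hdec x
    rw [h, Submodule.mem_bot] at hq
    rw [hq, add_zero, (hP v).1 hv, Module.End.one_apply]
  have hω : ∀ {y : L} {a : ℂ}, y ∈ Q → y ≠ 0 → g y = a • y → a ^ 2 ^ k = -1 := by
    intro y a hyQ hy0 hy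
    have h1 := pow_apply_of_apply_eq_smul hy (2 ^ k)
    rw [← hθ, (hQ y).1 hyQ] at h1
    exact (smul_left_injective ℂ hy0 (by simpa using h1)).symm
  have hω1 : ∀ {y : L} {a : ℂ}, y ∈ Q → y ≠ 0 → g y = a • y → a ≠ 1 := by
    rintro y a hyQ hy0 hy rfl
    have := hω hyQ hy0 hy
    norm_num at this
  have hli : ∀ {y : L} {a : ℂ}, y ∈ Q → y ≠ 0 → g y = a • y → LinearIndependent ℂ ![y, φ y] :=
    fun hyQ hy0 hy => linearIndependent_pair_antilinear hy0 hy (hnorm hy0 hy) (hω1 hyQ hy0 hy)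
  obtain ⟨y, hyQ, hy0, a, hy⟩ := exists_eigenvector_mem g Q hQ0
    fun q hq => hφQ _ (hφQ _ hq)
  -- `Q` is spanned by `y` and `φ y`
  have hQle : Q ≤ Submodule.span ℂ {y, φ y} := by
    by_contra hne
    obtain ⟨v, hvQ, hv⟩ := SetLike.not_le_iff_exists.1 hne
    have h4 := four_le_finrank_of_antilinear hφQ (fun q hq => (hQ q).1 hq) hyQ hy
      (hli hyQ hy0 hy) hvQ hv
    -- Here `Q` is everything, and `⁅Q, Q⁆ ⊆ P = 0` makes `L` abelian.
    have hP0 : P.toSubmodule = ⊥ := Submodule.finrank_eq_zero.1 (by omega)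
    have hP0' : ∀ x ∈ P, x = 0 := fun x hx => by
      have : x ∈ P.toSubmodule := hx
      rwa [hP0, Submodule.mem_bot] at this
    refine hab fun x z => ?_
    obtain ⟨v, hv, q, hq, rfl⟩ := hdec x
    obtain ⟨v', hv', q', hq', rfl⟩ := hdec z
    rw [hP0' v hv, hP0' v' hv', zero_add, zero_add]
    exact hP0' _ (hQQ q hq q' hq')
  have hspan2 : Module.finrank ℂ (Submodule.span ℂ {y, φ y}) = 2 := by
    have := finrank_span_eq_card (hli hyQ hy0 hy)
    rwa [Matrix.range_cons_cons_empty, Fintype.card_fin] at this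
  have hQ2 : Module.finrank ℂ Q = 2 := by
    have hle : Submodule.span ℂ {y, φ y} ≤ Q := by
      rw [Submodule.span_le]
      rintro _ (rfl | rfl)
      exacts [hyQ, hφQ _ hyQ]
    rw [le_antisymm hQle hle, hspan2]
  have hP2 : Module.finrank ℂ P.toSubmodule ≤ 2 := by omega
  have ha1 := hω1 hyQ hy0 hy
  have han := hnorm hy0 hy
  have hconj : ∀ {x : L} {b : ℂ}, g x = b • x → g (φ x) = conj b • φ x := fun {x b} h => by
    rw [hg, ← map_antilinearSq, ← hg, h, map_smulₛₗ]
  by_cases hgP : ∀ v ∈ P, g v = v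
  · -- a common eigenvector of `P` in `Q` that is also an eigenvector of `g`
    obtain ⟨y', hyQ', hy0', a', hy', hPy'⟩ : ∃ y' ∈ Q, y' ≠ 0 ∧ ∃ a' : ℂ, g y' = a' • y' ∧
        ∀ v ∈ P, ∃ c : ℂ, ⁅v, y'⁆ = c • y' := by
      -- For real `a`, `g` is scalar on `Q`, so any common eigenvector of `P` will do. Otherwise `y`
      -- and `φ y` have distinct eigenvalues, and `P`, commuting with `g`, preserves both lines.
      by_cases hreal : conj a = a
      · obtain ⟨y', hyQ', hy0', hPy'⟩ := exists_common_eigenvector_mem P hP2 Q hQ0 hPQ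
        refine ⟨y', hyQ', hy0', a, ?_, hPy'⟩
        obtain ⟨s, t, rfl⟩ := Submodule.mem_span_pair.1 (hQle hyQ')
        rw [map_add, map_smul, map_smul, hy, hconj hy, hreal]
        module
      · refine ⟨y, hyQ, hy0, a, hy, fun v hv => ?_⟩
        obtain ⟨s, t, hst⟩ := Submodule.mem_span_pair.1 (hQle (hPQ v hv y hyQ))
        have h1 : g ⁅v, y⁆ = a • ⁅v, y⁆ := by rw [g_lie, hgP v hv, hy, lie_smul]
        rw [← hst, map_add, map_smul, map_smul, hy, hconj hy, ← sub_eq_zero] at h1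
        have h2 : (0 : ℂ) • y + (t * (conj a - a)) • φ y = 0 := by
          rw [← h1]; module
        have h3 := (LinearIndependent.pair_iff.1 (hli hyQ hy0 hy) _ _ h2).2
        have ht : t = 0 := (mul_eq_zero.1 h3).resolve_right (sub_ne_zero.2 hreal)
        exact ⟨s, by rw [← hst, ht, zero_smul, add_zero]⟩
    have hli' := hli hyQ' hy0' hy'
    have hnot : ∀ {x z : L}, x ∈ Q → z ∈ Q → LinearIndependent ℂ ![z, x] →
        x ∉ P.toSubmodule ⊔ Submodule.span ℂ {z} := by
      intro x z hx hz hxz h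
      obtain ⟨v, hv, u, hu, hvu⟩ := Submodule.mem_sup.1 h
      obtain ⟨c, rfl⟩ := Submodule.mem_span_singleton.1 hu
      have hv0 : v = 0 := hPQ0 v hv (by
        rw [← eq_sub_iff_add_eq] at hvu
        rw [hvu]
        exact Q.sub_mem hx (Q.smul_mem _ hz))
      rw [hv0, zero_add] at hvu
      have hz0 : z ≠ 0 := by simpa using hxz.ne_zero 0
      exact (LinearIndependent.pair_iff' hz0).1 hxz c hvu
    refine exists_antilinear_involution_of_adapted hφ P hφP hgP hy' (hnorm hy0' hy') hPy'
      (hQQ _ hyQ' _ (hφQ _ hyQ')) (hnot hyQ' (hφQ _ hyQ') ?_) (hnot (hφQ _ hyQ') hyQ' hli') ?_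
    · rw [LinearIndependent.pair_iff] at hli' ⊢
      intro s t h
      exact (hli' t s (by rw [add_comm, h])).symm
    · intro x
      obtain ⟨v, hv, q, hq, rfl⟩ := hdec x
      obtain ⟨s, t, rfl⟩ := exists_eq_add_of_finrank_le_two hQ2.le hyQ' (hφQ _ hyQ') hli' hq
      exact ⟨v, hv, s, t, rfl⟩
  · -- otherwise all brackets vanish
    exfalso
    push Not at hgP
    obtain ⟨p, hp, hgp⟩ := hgP
    obtain ⟨x, hxP, hx0, b, hb1, hx⟩ := exists_eigenvector_of_ne_one (P := P.toSubmodule)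
      (fun v hv => hφP _ (hφP _ hv)) (pow_ne_zero k two_ne_zero) (fun v hv => (hP v).1 hv) hp hgp
    have hbn := hnorm hx0 hx
    have hlix : LinearIndependent ℂ ![x, φ x] := linearIndependent_pair_antilinear hx0 hx hbn hb1
    have hbk : b ^ 2 ^ k = 1 := by
      have h1 := pow_apply_of_apply_eq_smul hx (2 ^ k)
      rw [← hθ, (hP x).1 hxP] at h1
      exact smul_left_injective ℂ hx0 (by simpa using h1.symm)
    -- The eigenvalue `b ≠ 1` with `b ^ 2 ^ k = 1` excludes `k = 0`, so `a² = 1` would contradict `a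
    -- ^ 2 ^ k = -1`.
    have ha2 : a ^ 2 ≠ 1 := by
      intro h
      rcases k with _ | k
      · exact hb1 (by simpa using hbk)
      · have := hω hyQ hy0 hy
        rw [pow_succ', pow_mul, h, one_pow] at this
        norm_num at this
    have hPspan : ∀ {v}, v ∈ P → ∃ s t : ℂ, v = s • x + t • φ x := fun hv =>
      exists_eq_add_of_finrank_le_two (U := P.toSubmodule) hP2 hxP (hφP _ hxP) hlix hv
    have hQspan : ∀ {v}, v ∈ Q → ∃ s t : ℂ, v = s • y + t • φ y := fun hv =>
      exists_eq_add_of_finrank_le_two hQ2.le hyQ (hφQ _ hyQ) (hli hyQ hy0 hy) hv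
    have ha0 : a ≠ 0 := by rintro rfl; simp at han
    have haa : a * conj a = 1 := by
      rw [Complex.mul_conj, Complex.normSq_eq_norm_sq, han]; simp
    have hbb : b * conj b = 1 := by
      rw [Complex.mul_conj, Complex.normSq_eq_norm_sq, hbn]; simp
    have hca1 : conj a ≠ 1 := fun h => ha1 (by simpa [h] using haa)
    have hcb1 : conj b ≠ 1 := fun h => hb1 (by simpa [h] using hbb)
    have key : ∀ {u v w : L} {c d e s t : ℂ}, LinearIndependent ℂ ![u, v] → g u = c • u →
        g v = d • v → w = s • u + t • v → g w = e • w → (c ≠ e → s = 0) ∧ (d ≠ e → t = 0) := by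
      intro u v w c d e s t hl hu hv hw he
      rw [hw, map_add, map_smul, map_smul, hu, hv, ← sub_eq_zero] at he
      have h2 : (s * (c - e)) • u + (t * (d - e)) • v = 0 := by rw [← he]; module
      have h3 := LinearIndependent.pair_iff.1 hl _ _ h2
      exact ⟨fun h => (mul_eq_zero.1 h3.1).resolve_right (sub_ne_zero.2 h),
        fun h => (mul_eq_zero.1 h3.2).resolve_right (sub_ne_zero.2 h)⟩
    have hself : ∀ {u : L} {c : ℂ}, c * conj c = 1 → g u = c • u →
        g ⁅u, φ u⁆ = (1 : ℂ) • ⁅u, φ u⁆ := fun hc hu => by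
      rw [g_lie, hu, hconj hu, lie_smul, smul_lie, smul_smul, mul_comm, hc]
    -- `g` fixes `⁅u, φ u⁆`, but on `P` its eigenvalues are `b` and `conj b`, both different from 1.
    have vanish : ∀ {u : L} {c : ℂ}, c * conj c = 1 → g u = c • u → ⁅u, φ u⁆ ∈ P →
        ⁅u, φ u⁆ = 0 := by
      intro u c hc hu hP'
      obtain ⟨s, t, hst⟩ := hPspan hP'
      have := key hlix hx (hconj hx) hst (hself hc hu)
      rw [hst, this.1 hb1, this.2 hcb1, zero_smul, zero_smul, add_zero]
    -- `⁅x, y⁆` has eigenvalue `b * a ≠ a`, so it has no `y`-component; likewise `⁅x, φ y⁆` has no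
    -- `φ y`-component.
    obtain ⟨s, t, hst⟩ := hQspan (hPQ x hxP y hyQ)
    have hs : s = 0 := (key (hli hyQ hy0 hy) hy (hconj hy) hst
      (e := b * a) (by rw [g_lie, hx, hy, smul_lie, lie_smul, smul_smul])).1 fun h =>
        hb1 (mul_right_cancel₀ ha0 (by rw [← h, one_mul]))
    obtain ⟨s', t', hst'⟩ := hQspan (hPQ x hxP (φ y) (hφQ _ hyQ))
    have ht' : t' = 0 := (key (hli hyQ hy0 hy) hy (hconj hy) hst'
      (e := b * conj a) (by rw [g_lie, hx, hconj hy, smul_lie, lie_smul, smul_smul])).2 fun h =>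
        hb1 (mul_right_cancel₀ (right_ne_zero_of_mul_eq_one haa) (by rw [← h, one_mul]))
    rw [hs, zero_smul, zero_add] at hst
    rw [ht', zero_smul, add_zero] at hst'
    refine hab (abelian_of_adapted hφ hy0 hy han ha2
      (vanish hbb hx (P.lie_mem hxP (hφP _ hxP)))
      (vanish haa hy (hQQ _ hyQ _ (hφQ _ hyQ))) hst hst' fun z => ?_)
    obtain ⟨v, hv, q, hq, rfl⟩ := hdec z
    obtain ⟨p, q, rfl⟩ := hPspan hv
    obtain ⟨r, w, rfl⟩ := hQspan hq
    exact ⟨p, q, r, w, rfl⟩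

end RealForms

theorem mainTheorem10 (L : Type u) [LieRing L] [LieAlgebra ℂ L] [FiniteDimensional ℂ L]
    (hdim : Module.finrank ℂ L ≤ 4) :
    IsDefinedOver ℝ ℂ L ↔ Nonempty (L ≃ₗ⁅ℂ⁆ ComplexConjugateLie L) := by
  rw [ConjugateLie.nonempty_equiv_iff]
  refine ⟨exists_conj_equiv_of_isDefinedOver, ?_⟩
  rintro ⟨e, hsmul, hlie⟩
  let φ : L →ₛₗ[starRingEnd ℂ] L :=
    { toFun := e
      map_add' := e.map_add
      map_smul' := hsmul }
  obtain ⟨ψ, hψ, k, hk⟩ := exists_antilinear_two_power_order (φ := φ) hlie e.injective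
  obtain ⟨τ, hτ, hinv⟩ := exists_antilinear_involution_of_two_power_order hdim k ψ hψ hk
  exact isDefinedOver_real_of_involution τ hτ hinv
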